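/- Let $\mathbb{K}$ be a field, let $G$ be a finite simple graph with vertex set $\{x_1,\dots,x_n\}$, and let $J=I(G)=(x_ix_j : \{x_i,x_j\}\in E(G))$ be its edge ideal in $R=\mathbb{K}[x_1,\dots,x_n]$. Assume that $\mathrm{ht}(J)=r>1$. Let $\Theta$ be the Jacobian matrix of any finite system of generators of $J$, let $I_r(\Theta)$ be the ideal generated by its $r\times r$ minors, let $I=J+I_r(\Theta)$, and let $$\mathcal{VV}_{J}=\bigoplus_{t\ge 1}\frac{J\cap I^t}{J I^{t-1}}$$ be the Valabrega–Valla module of $J$. For a graded module $M=\bigoplus_i M_i\neq 0$ write $\mathrm{indeg}(M)=\min\{i : M_i\neq 0\}$ (and $\mathrm{indeg}(0)=\infty$). For a set $S$ of vertices let $N(S)$ be the set of all vertices adjacent to at least one vertex of $S$. Then the following are equivalent: (a) $\mathrm{indeg}(\mathcal{VV}_{J})=2$; (b) there are adjacent vertices $y_1,y_2$ of $G$ and other vertices $z_1,\dots,z_s$, for some integer $s\ge 1$, such that both $\{y_1,z_1,\dots,z_s\}$ and $\{y_2,z_1,\dots,z_s\}$ are independent in $G$ and $|N(\{z_1,\dots,z_s\})|=r-1$.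 -/

import Mathlib

open scoped DirectSum

namespace ValabregaValla

section Module

variable {R : Type*} [CommRing R]

/-- The component `(J ∩ I ^ t) / (J I ^ (t - 1))` of the Valabrega-Valla module of `J ⊆ I`.
For `t = 0` natural subtraction makes this `(J ∩ R) / (J R) = 0`. -/
abbrev Component (J I : Ideal R) (t : ℕ) : Type _ :=
  ↥(J ⊓ I ^ t) ⧸ Submodule.comap (J ⊓ I ^ t).subtype (J * I ^ (t - 1))

/-- The Valabrega-Valla module of the pair `J ⊆ I`, the direct sum over `t ≥ 1` of
`(J ∩ I ^ t) / (J I ^ (t - 1))`; the summand for `t = 0` is the zero module. -/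
abbrev VV (J I : Ideal R) : Type _ := ⨁ t : ℕ, Component J I t

/-- The homogeneous part of degree `t` of the Valabrega-Valla module. -/
def VV.grading (J I : Ideal R) (t : ℕ) : Submodule R (VV J I) :=
  LinearMap.range (DirectSum.lof R ℕ (Component J I) t)

/-- The initial degree of a graded module: the least `i` with nonzero part of degree `i`.
It is `⊤` for the zero module. -/
noncomputable def indeg {M : Type*} [AddCommMonoid M] [Module R M] (𝓜 : ℕ → Submodule R M) :
    ℕ∞ :=
  sInf {d | ∃ i : ℕ, 𝓜 i ≠ ⊥ ∧ d = i}

/-- The ideal generated by the `r × r` minors of a matrix. Repeated rows or columns are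
allowed, and contribute the minor `0`. -/
def minorsIdeal {m n : Type*} (A : Matrix m n R) (r : ℕ) : Ideal R :=
  Ideal.span {d | ∃ (rows : Fin r → m) (cols : Fin r → n), d = (A.submatrix rows cols).det}

end Module

section Jacobian

variable {K V : Type*} [Field K]

/-- The Jacobian matrix of a sequence of polynomials. -/
noncomputable def jacobianMatrix {s : ℕ} (f : Fin s → MvPolynomial V K) :
    Matrix (Fin s) V (MvPolynomial V K) :=
  Matrix.of fun i v => MvPolynomial.pderiv v (f i)

/-- The Jacobian ideal `J + I_r(Θ)` of `J = (f_1, …, f_s)`, where `r` is the height of `J` and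
`Θ` is the Jacobian matrix of `f_1, …, f_s`. -/
noncomputable def jacobianIdeal {s : ℕ} (f : Fin s → MvPolynomial V K) :
    Ideal (MvPolynomial V K) :=
  Ideal.span (Set.range f) ⊔
    minorsIdeal (jacobianMatrix f) (Ideal.span (Set.range f)).height.toNat

/-- The edge ideal of a graph. -/
noncomputable def edgeIdeal (K : Type*) [Field K] (G : SimpleGraph V) : Ideal (MvPolynomial V K) :=
  Ideal.span {p | ∃ u v : V, G.Adj u v ∧ p = MvPolynomial.X u * MvPolynomial.X v}

end Jacobian

/-- The neighbourhood `N(S)` of a set `S` of vertices: all vertices adjacent to some member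
of `S`. -/
def neighborhood {V : Type*} (G : SimpleGraph V) (S : Set V) : Set V :=
  ⋃ v ∈ S, G.neighborSet v

end ValabregaValla

/-! The degree 0 and 1 parts vanish, so initial degree 2 means `J ⊓ I ^ 2 ≤ J * I` fails. `I` does
not depend on the generators of `J`. With the edges as generators, each `r × r` minor is, modulo
`J`, a combination of monomials `∏ g w` over `r` distinct vertices `w`, with `g w` a neighbour of
`w` (`jacobianIdealOfSet_edges`). All ideals are thus monomial, and failure is witnessed by
exponents.

In a failure, two transversal monomials `b`, `b'` divide a multiple of an edge `y y'`, with `y ∣ b`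
and `y' ∣ b'`. Cancelling the edge leaves `P * P'`, divisible by no edge and no transversal
monomial. If `S` is its support, this forces `N(S)` to have exactly `r - 1` elements. Conversely,
from `S` pick a neighbour in `S` for each vertex of `N(S)`, with product `P`; then `b = x₁ P` and
`b' = x₂ P` break the containment. -/

namespace ValabregaValla

/-! ### Initial degree as an ideal containment -/

section Grading

variable {R : Type*} [CommRing R]

theorem grading_eq_bot_iff (J I : Ideal R) (t : ℕ) :
    VV.grading J I t = ⊥ ↔ J ⊓ I ^ t ≤ J * I ^ (t - 1) := by
  classical
  unfold VV.grading
  rw [LinearMap.range_eq_bot]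
  have h : DirectSum.lof R ℕ (Component J I) t = 0 ↔ Subsingleton (Component J I t) := by
    constructor
    · intro h
      refine ⟨fun a b => DirectSum.of_injective (β := Component J I) t ?_⟩
      have ha := LinearMap.congr_fun h a
      have hb := LinearMap.congr_fun h b
      exact ha.trans hb.symm
    · intro h
      ext x
      rw [Subsingleton.elim x 0, map_zero, map_zero]
  rw [h, Submodule.Quotient.subsingleton_iff, Submodule.comap_subtype_eq_top]

theorem indeg_grading_eq_two_iff (J I : Ideal R) :
    indeg (VV.grading J I) = 2 ↔ ¬ J ⊓ I ^ 2 ≤ J * I := by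
  -- In degree 0, `0 - 1 = 0` makes the denominator `J * I ^ 0 = J`.
  have h0 : VV.grading J I 0 = ⊥ := by rw [grading_eq_bot_iff]; simp
  have h1 : VV.grading J I 1 = ⊥ := by rw [grading_eq_bot_iff]; simp
  have h2 := grading_eq_bot_iff J I 2
  rw [show 2 - 1 = 1 from rfl, pow_one] at h2
  rw [← h2]
  unfold indeg
  constructor
  · intro h hb
    have h3 : (3 : ℕ∞) ≤ 2 := by
      rw [← h]
      refine le_sInf ?_
      rintro d ⟨i, hi, rfl⟩
      have : 3 ≤ i := by
        by_contra hlt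
        have : i = 0 ∨ i = 1 ∨ i = 2 := by omega
        rcases this with rfl | rfl | rfl <;> contradiction
      exact_mod_cast this
    exact absurd h3 (by decide)
  · intro h
    refine le_antisymm (sInf_le ⟨2, h, rfl⟩) (le_sInf ?_)
    rintro d ⟨i, hi, rfl⟩
    have : 2 ≤ i := by
      by_contra hlt
      have : i = 0 ∨ i = 1 := by omega
      rcases this with rfl | rfl <;> contradiction
    exact_mod_cast this

end Grading

/-! ### Independence of the choice of generators -/

section JacobianOfSet

open MvPolynomial

variable {K V : Type*} [Field K]

/-- The ideal generated by a set of polynomials and the `r × r` minors of its Jacobian matrix. -/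
noncomputable def jacobianIdealOfSet (A : Set (MvPolynomial V K)) (r : ℕ) :
    Ideal (MvPolynomial V K) :=
  Ideal.span A ⊔ Ideal.span {d | ∃ (p : Fin r → MvPolynomial V K) (c : Fin r → V),
    (∀ i, p i ∈ A) ∧ d = (Matrix.of fun i j => pderiv (c j) (p i)).det}

theorem _root_.MultilinearMap.map_mem_of_forall_mem_span {R M : Type*} [CommRing R]
    [AddCommGroup M] [Module R M] {r : ℕ} (D : MultilinearMap R (fun _ : Fin r => M) R)
    (T : Set M) (Q : Ideal R) (h : ∀ v : Fin r → M, (∀ i, v i ∈ T) → D v ∈ Q)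
    (v : Fin r → M) (hv : ∀ i, v i ∈ Submodule.span R T) : D v ∈ Q := by
  classical
  -- Induct on the set of slots whose entry is only known to lie in the span.
  have key : ∀ s : Finset (Fin r), ∀ v : Fin r → M, (∀ i ∈ s, v i ∈ Submodule.span R T) →
      (∀ i ∉ s, v i ∈ T) → D v ∈ Q := by
    intro s
    induction s using Finset.induction_on with
    | empty => exact fun v _ hv => h v fun i => hv i (by simp)
    | insert a s ha ih =>
      intro v hs hT
      have main : ∀ x ∈ Submodule.span R T, D (Function.update v a x) ∈ Q := by
        intro x hx
        induction hx using Submodule.span_induction with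
        | mem x hx =>
          refine ih _ (fun i hi => ?_) (fun i hi => ?_)
          · rw [Function.update_of_ne (by rintro rfl; exact ha hi)]
            exact hs i (Finset.mem_insert_of_mem hi)
          · by_cases hia : i = a
            · subst hia; simpa using hx
            · rw [Function.update_of_ne hia]
              exact hT i (by simp [hia, hi])
        | zero => rw [MultilinearMap.map_update_zero]; exact Q.zero_mem
        | add x y _ _ hx hy => rw [MultilinearMap.map_update_add]; exact Q.add_mem hx hy
        | smul c x _ hx => rw [MultilinearMap.map_update_smul]; exact Q.mul_mem_left c hx
      have := main (v a) (hs a (Finset.mem_insert_self _ _))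
      rwa [Function.update_eq_self] at this
  exact key Finset.univ v (fun i _ => hv i) (by simp)

/-- By the Leibniz rule, `∂(a q) = a ∂q + q ∂a`, and the last term has entries in the ideal; hence
the second family of spanning vectors. -/
theorem pderiv_mem_span_of_mem_span {r : ℕ} (c : Fin r → V) (B : Set (MvPolynomial V K))
    {p : MvPolynomial V K} (hp : p ∈ Ideal.span B) :
    (fun j => pderiv (c j) p) ∈ Submodule.span (MvPolynomial V K)
      ({v : Fin r → MvPolynomial V K | ∃ q ∈ B, v = fun j => pderiv (c j) q} ∪
        {v | ∀ j, v j ∈ Ideal.span B}) := by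
  induction hp using Submodule.span_induction with
  | mem x hx => exact Submodule.subset_span (Or.inl ⟨x, hx, rfl⟩)
  | zero => exact Submodule.subset_span (Or.inr fun j => by simp)
  | add x y _ _ hx hy =>
    convert Submodule.add_mem _ hx hy using 1
    ext1 j; simp
  | smul a x hx' hx =>
    have h2 : (fun j => x * pderiv (c j) a) ∈ Submodule.span (MvPolynomial V K)
      ({v : Fin r → MvPolynomial V K | ∃ q ∈ B, v = fun j => pderiv (c j) q} ∪
        {v | ∀ j, v j ∈ Ideal.span B}) :=
      Submodule.subset_span (Or.inr fun j => Ideal.mul_mem_right _ _ hx')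
    convert Submodule.add_mem _ (Submodule.smul_mem _ a hx) h2 using 1
    ext1 j
    simp only [smul_eq_mul, Derivation.leibniz, Pi.add_apply, Pi.smul_apply]

theorem jacobianIdealOfSet_le {A B : Set (MvPolynomial V K)} (h : Ideal.span A = Ideal.span B)
    (r : ℕ) : jacobianIdealOfSet A r ≤ jacobianIdealOfSet B r := by
  refine sup_le (h.le.trans le_sup_left) (Ideal.span_le.mpr ?_)
  rintro d ⟨p, c, hp, rfl⟩
  refine MultilinearMap.map_mem_of_forall_mem_span
    (Matrix.detRowAlternating (R := MvPolynomial V K) (n := Fin r)).toMultilinearMap _ _ ?_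
    (fun i j => pderiv (c j) (p i))
    (fun i => pderiv_mem_span_of_mem_span c B (h ▸ Ideal.subset_span (hp i)))
  intro v hv
  change Matrix.det (Matrix.of v) ∈ _
  by_cases hJ : ∃ i, ∀ j, v i j ∈ Ideal.span B
  · obtain ⟨i, hi⟩ := hJ
    refine Ideal.mem_sup_left ?_
    rw [Matrix.det_apply]
    refine Ideal.sum_mem _ fun σ _ => ?_
    rw [Units.smul_def, zsmul_eq_mul]
    refine Ideal.mul_mem_left _ _ ?_
    rw [← Finset.mul_prod_erase _ _ (Finset.mem_univ (σ.symm i))]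
    refine Ideal.mul_mem_right _ _ ?_
    simpa using hi _
  · push Not at hJ
    have hv' : ∀ i, ∃ q ∈ B, v i = fun j => pderiv (c j) q := by
      intro i
      rcases hv i with h | h
      · exact h
      · obtain ⟨j, hj⟩ := hJ i
        exact absurd (h j) hj
    choose q hq hvq using hv'
    refine Ideal.mem_sup_right (Ideal.subset_span ⟨q, c, hq, ?_⟩)
    congr 1
    ext1 i j
    simp [hvq]

theorem jacobianIdealOfSet_congr {A B : Set (MvPolynomial V K)}
    (h : Ideal.span A = Ideal.span B) (r : ℕ) :
    jacobianIdealOfSet A r = jacobianIdealOfSet B r :=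
  le_antisymm (jacobianIdealOfSet_le h r) (jacobianIdealOfSet_le h.symm r)

theorem jacobianIdeal_eq_jacobianIdealOfSet {s : ℕ} (f : Fin s → MvPolynomial V K) :
    jacobianIdeal f =
      jacobianIdealOfSet (Set.range f) (Ideal.span (Set.range f)).height.toNat := by
  unfold jacobianIdeal jacobianIdealOfSet minorsIdeal
  congr 2
  ext d
  constructor
  · rintro ⟨rows, cols, rfl⟩
    exact ⟨fun i => f (rows i), cols, fun i => ⟨_, rfl⟩, rfl⟩
  · rintro ⟨p, c, hp, rfl⟩
    choose rows hrows using hp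
    refine ⟨rows, c, ?_⟩
    congr 1
    ext1 i j
    simp [jacobianMatrix, hrows]

end JacobianOfSet

/-! ### Exponents of edge and transversal monomials -/

section Exponents

variable {V : Type*}

/-- The exponents of the monomials generating the edge ideal. -/
def edgeExponents (G : SimpleGraph V) : Set (V →₀ ℕ) :=
  {m | ∃ u v : V, G.Adj u v ∧ m = Finsupp.single u 1 + Finsupp.single v 1}

/-- The exponents of the monomials `∏ w ∈ W, X (g w)` where `W` is a set of `r` vertices and
`g w` is a neighbour of `w`. -/
def transversalExponents (G : SimpleGraph V) (r : ℕ) : Set (V →₀ ℕ) :=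
  {m | ∃ (W : Finset V) (g : V → V), W.card = r ∧ (∀ w ∈ W, G.Adj (g w) w) ∧
    m = ∑ w ∈ W, Finsupp.single (g w) 1}

theorem single_add_single_le_iff {u v : V} (h : u ≠ v) (m : V →₀ ℕ) :
    Finsupp.single u 1 + Finsupp.single v 1 ≤ m ↔ 1 ≤ m u ∧ 1 ≤ m v := by
  classical
  constructor
  · intro hm
    have h1 := hm u
    have h2 := hm v
    simp [h, h.symm] at h1 h2
    omega
  · rintro ⟨h1, h2⟩ x
    simp only [Finsupp.add_apply, Finsupp.single_apply]
    split_ifs with hu hv hv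
    · exact absurd (hu.trans hv.symm) h
    · subst hu; simpa using h1
    · subst hv; simpa using h2
    · simp

theorem one_le_sum_single_iff (W : Finset V) (g : V → V) (x : V) :
    1 ≤ (∑ w ∈ W, Finsupp.single (g w) 1 : V →₀ ℕ) x ↔ ∃ w ∈ W, g w = x := by
  classical
  rw [Finsupp.finsetSum_apply, Nat.one_le_iff_ne_zero, Ne, Finset.sum_eq_zero_iff]
  simp [Finsupp.single_apply]

theorem insert_mem_transversalExponents {G : SimpleGraph V} {W : Finset V} {g : V → V}
    (hW : ∀ w ∈ W, G.Adj (g w) w) {x y : V} (hx : x ∉ W) (hxy : G.Adj y x) :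
    Finsupp.single y 1 + ∑ w ∈ W, Finsupp.single (g w) 1 ∈
      transversalExponents G (W.card + 1) := by
  classical
  refine ⟨insert x W, Function.update g x y, by simp [hx], ?_, ?_⟩
  · intro w hw
    by_cases hwx : w = x
    · subst hwx; simpa using hxy
    · rw [Function.update_of_ne hwx]
      exact hW w (Finset.mem_of_mem_insert_of_ne hw hwx)
  · rw [Finset.sum_insert hx, Function.update_self]
    congr 1
    refine Finset.sum_congr rfl fun w hw => ?_
    rw [Function.update_of_ne (by rintro rfl; exact hx hw)]

end Exponents

/-! ### Reduction to monomial ideals -/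

section MonomialIdeal

open MvPolynomial

variable {K V : Type*} [Field K]

/-- The ideal generated by the monomials with exponents in a given set. -/
noncomputable def monomialIdeal (K : Type*) [Field K] (A : Set (V →₀ ℕ)) :
    Ideal (MvPolynomial V K) :=
  Ideal.span ((fun s => monomial s 1) '' A)

theorem monomialIdeal_sup (A B : Set (V →₀ ℕ)) :
    monomialIdeal K A ⊔ monomialIdeal K B = monomialIdeal K (A ∪ B) := by
  unfold monomialIdeal
  rw [Set.image_union, Ideal.span_union]

open Pointwise in
theorem monomialIdeal_mul (A B : Set (V →₀ ℕ)) :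
    monomialIdeal K A * monomialIdeal K B = monomialIdeal K (A + B) := by
  unfold monomialIdeal
  rw [Ideal.span_mul_span']
  congr 1
  ext p
  constructor
  · rintro ⟨_, ⟨a, ha, rfl⟩, _, ⟨b, hb, rfl⟩, rfl⟩
    exact ⟨a + b, ⟨a, ha, b, hb, rfl⟩, by simp [monomial_mul]⟩
  · rintro ⟨_, ⟨a, ha, b, hb, rfl⟩, rfl⟩
    exact ⟨_, ⟨a, ha, rfl⟩, _, ⟨b, hb, rfl⟩, by simp [monomial_mul]⟩

theorem mem_monomialIdeal_iff (A : Set (V →₀ ℕ)) (p : MvPolynomial V K) :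
    p ∈ monomialIdeal K A ↔ ∀ m ∈ p.support, ∃ a ∈ A, a ≤ m :=
  mem_ideal_span_monomial_image

theorem monomial_mem_monomialIdeal_iff (A : Set (V →₀ ℕ)) (m : V →₀ ℕ) :
    monomial m (1 : K) ∈ monomialIdeal K A ↔ ∃ a ∈ A, a ≤ m := by
  classical
  rw [mem_monomialIdeal_iff, support_monomial, if_neg one_ne_zero]
  simp

open Pointwise in
theorem monomialIdeal_inf_sq_le_iff (A C : Set (V →₀ ℕ)) :
    monomialIdeal K A ⊓ monomialIdeal K C ^ 2 ≤ monomialIdeal K A * monomialIdeal K C ↔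
      ∀ m, ∀ a ∈ A, ∀ b ∈ C, ∀ b' ∈ C, a ≤ m → b + b' ≤ m → ∃ a' ∈ A, ∃ c ∈ C, a' + c ≤ m := by
  rw [pow_two, monomialIdeal_mul, monomialIdeal_mul]
  constructor
  · intro h m a ha b hb b' hb' ham hbm
    have : monomial m (1 : K) ∈ monomialIdeal K A ⊓ monomialIdeal K (C + C) :=
      ⟨(monomial_mem_monomialIdeal_iff _ _).2 ⟨a, ha, ham⟩,
        (monomial_mem_monomialIdeal_iff _ _).2 ⟨_, ⟨b, hb, b', hb', rfl⟩, hbm⟩⟩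
    obtain ⟨_, ⟨a', ha', c, hc, rfl⟩, hm⟩ := (monomial_mem_monomialIdeal_iff _ _).1 (h this)
    exact ⟨a', ha', c, hc, hm⟩
  · rintro h p ⟨h1, h2⟩
    refine (mem_monomialIdeal_iff _ _).2 fun m hm => ?_
    obtain ⟨a, ha, ham⟩ := (mem_monomialIdeal_iff _ _).1 h1 m hm
    obtain ⟨_, ⟨b, hb, b', hb', rfl⟩, hbm⟩ := (mem_monomialIdeal_iff _ _).1 h2 m hm
    obtain ⟨a', ha', c, hc, hm⟩ := h m a ha b hb b' hb' ham hbm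
    exact ⟨_, ⟨a', ha', c, hc, rfl⟩, hm⟩

theorem monomial_single_add_single (u v : V) :
    monomial (Finsupp.single u 1 + Finsupp.single v 1) (1 : K) = X u * X v := by
  simp [X, monomial_mul]

theorem monomial_sum_single {ι : Type*} (W : Finset ι) (g : ι → V) :
    monomial (∑ w ∈ W, Finsupp.single (g w) 1) (1 : K) = ∏ w ∈ W, X (g w) := by
  rw [monomial_sum_one]; rfl

theorem edgeIdeal_eq_monomialIdeal (G : SimpleGraph V) :
    edgeIdeal K G = monomialIdeal K (edgeExponents G) := by
  unfold edgeIdeal monomialIdeal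
  congr 1
  ext p
  constructor
  · rintro ⟨u, v, h, rfl⟩
    exact ⟨_, ⟨u, v, h, rfl⟩, monomial_single_add_single u v⟩
  · rintro ⟨_, ⟨u, v, h, rfl⟩, rfl⟩
    exact ⟨u, v, h, monomial_single_add_single u v⟩

theorem prod_X_mem_monomialIdeal {G : SimpleGraph V} {r : ℕ} {u w : Fin r → V}
    (hw : Function.Injective w) (h : ∀ i, G.Adj (u i) (w i)) :
    ∏ i, X (u i) ∈ monomialIdeal K (transversalExponents G r) := by
  classical
  refine Ideal.subset_span ⟨∑ i, Finsupp.single (u i) 1,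
    ⟨Finset.univ.image w, Function.extend w u id, ?_, ?_, ?_⟩, monomial_sum_single _ _⟩
  · rw [Finset.card_image_of_injective _ hw, Finset.card_univ, Fintype.card_fin]
  · intro x hx
    obtain ⟨i, -, rfl⟩ := Finset.mem_image.1 hx
    rw [hw.extend_apply]
    exact h i
  · rw [Finset.sum_image hw.injOn]
    simp_rw [hw.extend_apply]

theorem pderiv_X_mul_X [DecidableEq V] (c u v : V) :
    pderiv c (X u * X v : MvPolynomial V K) =
      (if c = v then X u else 0) + (if c = u then X v else 0) := by
  rw [Derivation.leibniz, pderiv_X, pderiv_X]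
  simp only [smul_eq_mul, Pi.single_apply, mul_ite, mul_one, mul_zero]
  simp only [eq_comm]

theorem pderiv_edge {G : SimpleGraph V} {u v : V} (h : G.Adj u v) (c : V) :
    pderiv c (X u * X v : MvPolynomial V K) = 0 ∨
      ∃ y, G.Adj y c ∧ pderiv c (X u * X v : MvPolynomial V K) = X y := by
  classical
  rw [pderiv_X_mul_X]
  by_cases hv : c = v
  · subst hv
    exact Or.inr ⟨u, h, by simp [h.ne']⟩
  · by_cases hu : c = u
    · subst hu
      exact Or.inr ⟨v, h.symm, by simp [hv]⟩
    · exact Or.inl (by simp [hu, hv])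

/-- Every entry of the Jacobian matrix of the edges is zero or a variable adjacent to its column.
Conversely, a transversal monomial outside `J` is the determinant of a diagonal submatrix. -/
theorem jacobianIdealOfSet_edges (G : SimpleGraph V) (r : ℕ) :
    jacobianIdealOfSet {p : MvPolynomial V K | ∃ u v : V, G.Adj u v ∧ p = X u * X v} r =
      monomialIdeal K (edgeExponents G ∪ transversalExponents G r) := by
  classical
  rw [← monomialIdeal_sup, ← edgeIdeal_eq_monomialIdeal]
  refine le_antisymm (sup_le le_sup_left ?_) (sup_le le_sup_left ?_)
  · refine le_trans (Ideal.span_le.2 ?_) le_sup_right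
    rintro d ⟨p, c, hp, rfl⟩
    by_cases hc : Function.Injective c
    · rw [Matrix.det_apply]
      refine Ideal.sum_mem _ fun σ _ => ?_
      rw [Units.smul_def, zsmul_eq_mul]
      refine Ideal.mul_mem_left _ _ ?_
      simp only [Matrix.of_apply]
      by_cases h0 : ∃ i, pderiv (c i) (p (σ i)) = 0
      · obtain ⟨i, hi⟩ := h0
        rw [Finset.prod_eq_zero (Finset.mem_univ i) hi]
        exact Ideal.zero_mem _
      · push Not at h0
        have : ∀ i, ∃ y, G.Adj y (c i) ∧ pderiv (c i) (p (σ i)) = X y := by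
          intro i
          obtain ⟨u, v, huv, he⟩ := hp (σ i)
          have := pderiv_edge (K := K) huv (c i)
          rw [← he] at this
          exact this.resolve_left (h0 i)
        choose y hy hyp using this
        simp_rw [hyp]
        exact prod_X_mem_monomialIdeal hc hy
    · rw [Function.not_injective_iff] at hc
      obtain ⟨i, j, hij, hne⟩ := hc
      rw [Matrix.det_zero_of_column_eq hne (by intro k; simp [hij])]
      exact Ideal.zero_mem _
  · refine Ideal.span_le.2 ?_
    rintro _ ⟨_, ⟨W, g, hWr, hg, rfl⟩, rfl⟩
    by_cases hJ : ∃ a ∈ edgeExponents G, a ≤ ∑ w ∈ W, Finsupp.single (g w) 1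
    · refine Ideal.mem_sup_left ?_
      have := (monomial_mem_monomialIdeal_iff (K := K) _ _).2 hJ
      rwa [← edgeIdeal_eq_monomialIdeal] at this
    · refine Ideal.mem_sup_right (Ideal.subset_span ?_)
      let e := W.equivFinOfCardEq hWr
      refine ⟨fun i => X (g (e.symm i)) * X (e.symm i : V), fun i => e.symm i,
        fun i => ⟨_, _, hg _ (e.symm i).2, rfl⟩, ?_⟩
      have hdiag : (Matrix.of fun i j => pderiv (e.symm j : V)
          (X (g (e.symm i)) * X (e.symm i : V) : MvPolynomial V K)) =
          Matrix.diagonal fun i => X (g (e.symm i)) := by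
        ext1 i j
        -- Otherwise `g (e.symm j)` and `g (e.symm i)` would be adjacent, and that edge would divide
        -- the monomial.
        have h2 : (e.symm j : V) ≠ g (e.symm i) := by
          intro h
          have hadj : G.Adj (g (e.symm j)) (g (e.symm i)) := h ▸ hg _ (e.symm j).2
          refine hJ ⟨_, ⟨_, _, hadj, rfl⟩, ?_⟩
          rw [single_add_single_le_iff hadj.ne, one_le_sum_single_iff, one_le_sum_single_iff]
          exact ⟨⟨_, (e.symm j).2, rfl⟩, ⟨_, (e.symm i).2, rfl⟩⟩
        rw [Matrix.of_apply, pderiv_X_mul_X, if_neg h2, add_zero, Matrix.diagonal_apply]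
        by_cases hij : i = j
        · subst hij; simp
        · rw [if_neg hij, if_neg]
          intro h
          exact hij (e.symm.injective (Subtype.ext h)).symm
      rw [hdiag, Matrix.det_diagonal]
      change monomial _ _ = _
      rw [monomial_sum_single, ← Finset.prod_coe_sort]
      exact (Equiv.prod_comp e.symm fun w : W => (X (g w) : MvPolynomial V K)).symm

end MonomialIdeal

/-! ### Failing monomials versus independent sets -/

section Combinatorics

variable {V : Type*}

theorem mem_neighborhood {G : SimpleGraph V} {S : Set V} {w : V} :
    w ∈ neighborhood G S ↔ ∃ z ∈ S, G.Adj z w := by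
  simp [neighborhood]

/-- Write `m = b + b' + n`. The edge divides neither `b' + n` nor `b + n`, so each factor must
supply one endpoint. -/
theorem edge_splits {m b b' : V →₀ ℕ} {y y' : V} (hne : y ≠ y') (hm : 1 ≤ m y) (hm' : 1 ≤ m y')
    (hb : b + b' ≤ m)
    (h : ¬ Finsupp.single y 1 + Finsupp.single y' 1 + b ≤ m)
    (h' : ¬ Finsupp.single y 1 + Finsupp.single y' 1 + b' ≤ m) :
    (1 ≤ b y ∧ 1 ≤ b' y') ∨ (1 ≤ b y' ∧ 1 ≤ b' y) := by
  obtain ⟨n, rfl⟩ := le_iff_exists_add.1 hb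
  have e : Finsupp.single y 1 + Finsupp.single y' 1 ≤ b' + n →
      Finsupp.single y 1 + Finsupp.single y' 1 + b ≤ b + b' + n := fun h => by
    rw [add_assoc b, add_comm _ b]; gcongr
  have e' : Finsupp.single y 1 + Finsupp.single y' 1 ≤ b + n →
      Finsupp.single y 1 + Finsupp.single y' 1 + b' ≤ b + b' + n := fun h => by
    rw [add_comm b, add_assoc b', add_comm _ b']; gcongr
  have k := mt e h
  have k' := mt e' h'
  rw [single_add_single_le_iff hne] at k k'
  simp only [Finsupp.add_apply] at k k' hm hm'
  omega

theorem exists_independent_of_splitting {G : SimpleGraph V} {r : ℕ} (hr : 1 < r)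
    {b b' : V →₀ ℕ} (hb : b ∈ transversalExponents G r) (hb' : b' ∈ transversalExponents G r)
    {y y' : V} (hy : G.Adj y y') (hby : 1 ≤ b y) (hby' : 1 ≤ b' y')
    (h : ∀ a ∈ edgeExponents G, ∀ c ∈ edgeExponents G ∪ transversalExponents G r,
      ¬ a + c ≤ b + b') :
    ∃ (x₁ x₂ : V) (S : Set V), G.Adj x₁ x₂ ∧ S.Nonempty ∧ x₁ ∉ S ∧ x₂ ∉ S ∧
      G.IsIndepSet (insert x₁ S) ∧ G.IsIndepSet (insert x₂ S) ∧
      (neighborhood G S).ncard = r - 1 := by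
  classical
  have hind : ∀ u v, 1 ≤ b u → 1 ≤ b v → ¬ G.Adj u v := fun u v hu hv huv =>
    h _ ⟨u, v, huv, rfl⟩ b' (Or.inr hb')
      (add_le_add ((single_add_single_le_iff huv.ne b).2 ⟨hu, hv⟩) le_rfl)
  have hind' : ∀ u v, 1 ≤ b' u → 1 ≤ b' v → ¬ G.Adj u v := fun u v hu hv huv =>
    h _ ⟨u, v, huv, rfl⟩ b (Or.inr hb) (by
      rw [add_comm b]
      exact add_le_add ((single_add_single_le_iff huv.ne b').2 ⟨hu, hv⟩) le_rfl)
  obtain ⟨W, g, hWr, hg, rfl⟩ := hb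
  obtain ⟨W', g', hWr', hg', rfl⟩ := hb'
  simp only [one_le_sum_single_iff] at hind hind' hby hby'
  obtain ⟨w, hw, rfl⟩ := hby
  obtain ⟨w', hw', rfl⟩ := hby'
  set P : V →₀ ℕ := ∑ x ∈ W.erase w, Finsupp.single (g x) 1 with hP
  set P' : V →₀ ℕ := ∑ x ∈ W'.erase w', Finsupp.single (g' x) 1 with hP'
  have hc : ∀ c ∈ edgeExponents G ∪ transversalExponents G r, ¬ c ≤ P + P' := by
    intro c hc hle
    refine h _ ⟨_, _, hy, rfl⟩ c hc ?_
    rw [← Finset.add_sum_erase W _ hw, ← Finset.add_sum_erase W' _ hw', add_add_add_comm]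
    exact add_le_add le_rfl hle
  have hcard : (W.erase w).card + 1 = r := by rw [Finset.card_erase_of_mem hw]; omega
  have hcard' : (W'.erase w').card + 1 = r := by rw [Finset.card_erase_of_mem hw']; omega
  have hgE : ∀ x ∈ W.erase w, G.Adj (g x) x := fun x hx => hg x (Finset.mem_of_mem_erase hx)
  have hgE' : ∀ x ∈ W'.erase w', G.Adj (g' x) x := fun x hx => hg' x (Finset.mem_of_mem_erase hx)
  have single_le : ∀ (U : Finset V) (k : V → V) (z : V), z ∈ U →
      Finsupp.single (k z) 1 ≤ (∑ x ∈ U, Finsupp.single (k x) 1 : V →₀ ℕ) := fun U k z hz => by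
    rw [← Finset.add_sum_erase U _ hz]; exact le_self_add
  -- A neighbour `x` of `g' z` outside `W.erase w` would extend `P` by `g' z` to a transversal
  -- monomial dividing `P + P'`.
  have hN' : ∀ z ∈ W'.erase w', ∀ x, G.Adj (g' z) x → x ∈ W.erase w := by
    intro z hz x hx
    by_contra hxW
    have := insert_mem_transversalExponents hgE hxW hx
    rw [hcard] at this
    refine hc _ (Or.inr this) ?_
    rw [add_comm P]
    exact add_le_add (single_le _ g' z hz) le_rfl
  have hN : ∀ z ∈ W.erase w, ∀ x, G.Adj (g z) x → x ∈ W'.erase w' := by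
    intro z hz x hx
    by_contra hxW
    have := insert_mem_transversalExponents hgE' hxW hx
    rw [hcard'] at this
    exact hc _ (Or.inr this) (add_le_add (single_le _ g z hz) le_rfl)
  have hWW : W.erase w = W'.erase w' := by
    ext x
    exact ⟨fun hx => hN x hx x (hgE x hx), fun hx => hN' x hx x (hgE' x hx)⟩
  have hmem : ∀ z, 1 ≤ (P + P') z ↔ (∃ x ∈ W.erase w, g x = z) ∨ ∃ x ∈ W'.erase w', g' x = z := by
    intro z
    rw [← one_le_sum_single_iff, ← one_le_sum_single_iff, ← hP, ← hP', Finsupp.add_apply]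
    omega
  have hNS : neighborhood G {z | 1 ≤ (P + P') z} = ↑(W.erase w) := by
    ext x
    rw [mem_neighborhood]
    constructor
    · rintro ⟨z, hz, hzx⟩
      rcases (hmem z).1 hz with ⟨t, ht, rfl⟩ | ⟨t, ht, rfl⟩
      · rw [hWW]; exact hN t ht x hzx
      · exact hN' t ht x hzx
    · intro hx
      exact ⟨g x, (hmem _).2 (Or.inl ⟨x, hx, rfl⟩), hgE x hx⟩
  -- Otherwise `g w` lies in `W.erase w`, so `b` contains the edge from `g w` to `g (g w)`.
  have nadj : ∀ z, 1 ≤ (P + P') z → ¬ G.Adj (g w) z := by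
    intro z hz hadj
    have : g w ∈ neighborhood G {z | 1 ≤ (P + P') z} := mem_neighborhood.2 ⟨z, hz, hadj.symm⟩
    rw [hNS] at this
    have hx := Finset.mem_of_mem_erase (Finset.mem_coe.1 this)
    exact hind _ _ ⟨_, hx, rfl⟩ ⟨_, hw, rfl⟩ (hg _ hx)
  have nadj' : ∀ z, 1 ≤ (P + P') z → ¬ G.Adj (g' w') z := by
    intro z hz hadj
    have : g' w' ∈ neighborhood G {z | 1 ≤ (P + P') z} := mem_neighborhood.2 ⟨z, hz, hadj.symm⟩
    rw [hNS, hWW] at this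
    have hx := Finset.mem_of_mem_erase (Finset.mem_coe.1 this)
    exact hind' _ _ ⟨_, hx, rfl⟩ ⟨_, hw', rfl⟩ (hg' _ hx)
  have hS : G.IsIndepSet {z | 1 ≤ (P + P') z} := fun u hu v hv huv hadj =>
    hc _ (Or.inl ⟨u, v, hadj, rfl⟩) ((single_add_single_le_iff huv _).2 ⟨hu, hv⟩)
  refine ⟨g w, g' w', {z | 1 ≤ (P + P') z}, hy, ?_, fun hz => nadj' _ hz hy.symm,
    fun hz => nadj _ hz hy, ?_, ?_, ?_⟩
  · have : (W.erase w).Nonempty := by rw [← Finset.card_pos]; omega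
    obtain ⟨x, hx⟩ := this
    exact ⟨g x, (hmem _).2 (Or.inl ⟨x, hx, rfl⟩)⟩
  · exact Set.pairwise_insert.2 ⟨hS, fun z hz _ => ⟨nadj z hz, fun h => nadj z hz h.symm⟩⟩
  · exact Set.pairwise_insert.2 ⟨hS, fun z hz _ => ⟨nadj' z hz, fun h => nadj' z hz h.symm⟩⟩
  · rw [hNS, Set.ncard_coe_finset]; omega

theorem exists_splitting_of_independent [Finite V] {G : SimpleGraph V} {r : ℕ} (hr : 1 < r)
    {x₁ x₂ : V} {S : Set V} (hx : G.Adj x₁ x₂)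
    (hS₁ : G.IsIndepSet (insert x₁ S)) (hS₂ : G.IsIndepSet (insert x₂ S))
    (hcard : (neighborhood G S).ncard = r - 1) :
    ∃ b ∈ transversalExponents G r, ∃ b' ∈ transversalExponents G r,
      Finsupp.single x₁ 1 + Finsupp.single x₂ 1 ≤ b + b' ∧
      ∀ a ∈ edgeExponents G, ∀ c ∈ edgeExponents G ∪ transversalExponents G r,
        ¬ a + c ≤ b + b' := by
  classical
  have nadj₁ : ∀ z ∈ S, ¬ G.Adj x₁ z := fun z hz h =>
    hS₁ (Set.mem_insert _ _) (Set.mem_insert_of_mem _ hz) h.ne h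
  have nadj₂ : ∀ z ∈ S, ¬ G.Adj x₂ z := fun z hz h =>
    hS₂ (Set.mem_insert _ _) (Set.mem_insert_of_mem _ hz) h.ne h
  have nadj : ∀ z ∈ S, ∀ z' ∈ S, ¬ G.Adj z z' := fun z hz z' hz' h =>
    hS₂ (Set.mem_insert_of_mem _ hz) (Set.mem_insert_of_mem _ hz') h.ne h
  let N : Finset V := (Set.toFinite (neighborhood G S)).toFinset
  have hmemN : ∀ w, w ∈ N ↔ ∃ z ∈ S, G.Adj z w := fun w => by
    rw [Set.Finite.mem_toFinset, mem_neighborhood]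
  have hN : N.card + 1 = r := by
    rw [← Set.ncard_eq_toFinset_card _ _, hcard]; omega
  have hg : ∀ w, ∃ z, w ∈ N → z ∈ S ∧ G.Adj z w := by
    intro w
    by_cases hw : w ∈ N
    · obtain ⟨z, hz⟩ := (hmemN w).1 hw
      exact ⟨z, fun _ => hz⟩
    · exact ⟨w, fun h => absurd h hw⟩
  choose g hg using hg
  have hx₁N : x₁ ∉ N := fun h => by
    obtain ⟨z, hz, hadj⟩ := (hmemN _).1 h
    exact nadj₁ z hz hadj.symm
  have hx₂N : x₂ ∉ N := fun h => by
    obtain ⟨z, hz, hadj⟩ := (hmemN _).1 h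
    exact nadj₂ z hz hadj.symm
  have m₁ := insert_mem_transversalExponents (fun w hw => (hg w hw).2) hx₂N hx
  have m₂ := insert_mem_transversalExponents (fun w hw => (hg w hw).2) hx₁N hx.symm
  rw [hN] at m₁ m₂
  set P : V →₀ ℕ := ∑ w ∈ N, Finsupp.single (g w) 1 with hP
  have hPS : ∀ z, 1 ≤ P z → z ∈ S := fun z hz => by
    obtain ⟨w, hw, rfl⟩ := (one_le_sum_single_iff _ _ _).1 hz
    exact (hg w hw).1
  have hPPS : ∀ z, 1 ≤ (P + P) z → z ∈ S := fun z hz => hPS z (by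
    rw [Finsupp.add_apply] at hz; omega)
  refine ⟨_, m₁, _, m₂, ?_, ?_⟩
  · rw [add_add_add_comm]; exact le_self_add
  · rw [add_add_add_comm]
    rintro _ ⟨u, v, huv, rfl⟩ c hc hle
    have hsupp : ∀ z, 1 ≤ (Finsupp.single x₁ 1 + Finsupp.single x₂ 1 + (P + P) : V →₀ ℕ) z →
        z = x₁ ∨ z = x₂ ∨ z ∈ S := by
      intro z hz
      by_cases h1 : z = x₁
      · exact Or.inl h1
      by_cases h2 : z = x₂
      · exact Or.inr (Or.inl h2)
      refine Or.inr (Or.inr (hPPS z ?_))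
      simpa [Finsupp.single_apply, Ne.symm h1, Ne.symm h2] using hz
    obtain ⟨hu, hv⟩ := (single_add_single_le_iff huv.ne _).1 (le_self_add.trans hle)
    -- `x₁ x₂` is the only edge inside the support, so removing any edge leaves `P + P`.
    have huv' : Finsupp.single u 1 + Finsupp.single v 1 =
        (Finsupp.single x₁ 1 + Finsupp.single x₂ 1 : V →₀ ℕ) := by
      rcases hsupp u hu with eu | eu | eu <;> rcases hsupp v hv with ev | ev | ev
      · exact absurd (eu.trans ev.symm) huv.ne
      · rw [eu, ev]
      · exact absurd (eu ▸ huv) (nadj₁ _ ev)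
      · rw [eu, ev, add_comm]
      · exact absurd (eu.trans ev.symm) huv.ne
      · exact absurd (eu ▸ huv) (nadj₂ _ ev)
      · exact absurd (ev ▸ huv.symm) (nadj₁ _ eu)
      · exact absurd (ev ▸ huv.symm) (nadj₂ _ eu)
      · exact absurd huv (nadj _ eu _ ev)
    rw [huv', add_le_add_iff_left] at hle
    rcases hc with ⟨p, q, hpq, rfl⟩ | ⟨W, k, hW, hk, rfl⟩
    · obtain ⟨hp, hq⟩ := (single_add_single_le_iff hpq.ne _).1 hle
      exact nadj _ (hPPS p hp) _ (hPPS q hq) hpq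
    -- A transversal of `P + P` uses neighbours of `S` only, and there are just `r - 1` of them.
    · have hWN : W ⊆ N := fun w hw => by
        refine (hmemN w).2 ⟨k w, hPPS _ ?_, hk w hw⟩
        exact ((one_le_sum_single_iff W k _).2 ⟨w, hw, rfl⟩).trans (hle _)
      have := Finset.card_le_card hWN
      omega

end Combinatorics

end ValabregaValla

open ValabregaValla in
theorem edgeIdeal_inf_sq_le_iff {K V : Type*} [Field K] [Finite V] (G : SimpleGraph V) {r : ℕ}
    (hr : 1 < r) :
    (¬ edgeIdeal K G ⊓ monomialIdeal K (edgeExponents G ∪ transversalExponents G r) ^ 2 ≤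
        edgeIdeal K G * monomialIdeal K (edgeExponents G ∪ transversalExponents G r)) ↔
      ∃ (x₁ x₂ : V) (S : Set V), G.Adj x₁ x₂ ∧ S.Nonempty ∧ x₁ ∉ S ∧ x₂ ∉ S ∧
        G.IsIndepSet (insert x₁ S) ∧ G.IsIndepSet (insert x₂ S) ∧
        (neighborhood G S).ncard = r - 1 := by
  rw [edgeIdeal_eq_monomialIdeal, monomialIdeal_inf_sq_le_iff]
  constructor
  · intro h
    push Not at h
    obtain ⟨m, _, ⟨y, y', hy, rfl⟩, b, hb, b', hb', ham, hbm, hno⟩ := h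
    -- If `b` were an edge, `b + b'` would already witness membership in `J * I`.
    have hbT : b ∈ transversalExponents G r :=
      hb.resolve_left fun hbE => hno b hbE b' hb' hbm
    have hbT' : b' ∈ transversalExponents G r :=
      hb'.resolve_left fun hbE => hno b' hbE b hb (by rwa [add_comm])
    obtain ⟨hmy, hmy'⟩ := (single_add_single_le_iff hy.ne m).1 ham
    have hno' : ∀ a ∈ edgeExponents G, ∀ c ∈ edgeExponents G ∪ transversalExponents G r,
        ¬ a + c ≤ b + b' := fun a ha c hc hle => hno a ha c hc (hle.trans hbm)
    rcases edge_splits hy.ne hmy hmy' hbm (hno _ ⟨y, y', hy, rfl⟩ b hb)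
      (hno _ ⟨y, y', hy, rfl⟩ b' hb') with ⟨h1, h2⟩ | ⟨h1, h2⟩
    · exact exists_independent_of_splitting hr hbT hbT' hy h1 h2 hno'
    · exact exists_independent_of_splitting hr hbT hbT' hy.symm h1 h2 hno'
  · rintro ⟨x₁, x₂, S, hx, -, -, -, hS₁, hS₂, hcard⟩ h
    obtain ⟨b, hb, b', hb', hle, hno⟩ :=
      exists_splitting_of_independent hr hx hS₁ hS₂ hcard
    obtain ⟨a, ha, c, hc, hac⟩ :=
      h _ _ ⟨x₁, x₂, hx, rfl⟩ b (Or.inr hb) b' (Or.inr hb') hle le_rfl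
    exact hno a ha c hc hac

theorem proposition3p5 {K V : Type*} [Field K] [Finite V] (G : SimpleGraph V) (r : ℕ)
    (hr : 1 < r) (hht : (ValabregaValla.edgeIdeal K G).height = r)
    {s : ℕ} (f : Fin s → MvPolynomial V K)
    (hf : Ideal.span (Set.range f) = ValabregaValla.edgeIdeal K G) :
    ValabregaValla.indeg
        (ValabregaValla.VV.grading (ValabregaValla.edgeIdeal K G)
          (ValabregaValla.jacobianIdeal f)) = 2 ↔
      ∃ (x₁ x₂ : V) (S : Set V), G.Adj x₁ x₂ ∧ S.Nonempty ∧ x₁ ∉ S ∧ x₂ ∉ S ∧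
        G.IsIndepSet (insert x₁ S) ∧ G.IsIndepSet (insert x₂ S) ∧
        (ValabregaValla.neighborhood G S).ncard = r - 1 := by
  rw [ValabregaValla.indeg_grading_eq_two_iff,
    ValabregaValla.jacobianIdeal_eq_jacobianIdealOfSet, hf, hht, ENat.toNat_natCast,
    ValabregaValla.jacobianIdealOfSet_congr hf, ValabregaValla.jacobianIdealOfSet_edges]
  exact edgeIdeal_inf_sq_le_iff G hr
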